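/- Let $B$ and $Y$ be real Banach spaces that are linear subspaces of a common vector space (no topology on it and no continuous embedding between $B$ and $Y$ is assumed), so that $B\cap Y$ makes sense. Let $M_+\subset B$ be a seminormed nonnegative cone, i.e. $cu\in M_+$ for all $u\in M_+$, $c\ge 0$, and there is a function $[\cdot]:M_+\to[0,\infty)$ such that $[u]=0$ if and only if $u=0$, and $[cu]=c[u]$ for all $u\in M_+$, $c\ge 0$. Let either $1\le p<\infty$ and $r=1$, or $p=\infty$ and $1<r\le\infty$. Let $T>0$, and let $(u_\tau)$ be a sequence of functions in $L^p(0,T;B)$ with values in $M_+\cap Y$, where $\tau$ runs through a sequence of step sizes of the form $\tau=T/N$, $N\in\mathbb N$, $N\ge 1$, and $u_\tau$ is constant on each interval $((k-1)\tau,k\tau]$, $1\le k\le N$. Assume: (i) every sequence $(w_n)\subset M_+$ with $\sup_n[w_n]<\infty$ has a subsequence that converges in $B$; (ii) if $(w_n)\subset B\cap Y$, $w_n\to w$ in $B$ and $w_n\to 0$ in $Y$ as $n\to\infty$, then $w=0$; (iii) the norms $\|[u_\tau]\|_{L^p(0,T)}$ are bounded uniformly in $\tau$; (iv) there is $C>0$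 such that $\|\sigma_\tau u_\tau-u_\tau\|_{L^r(0,T-\tau;Y)}\le C\tau$ for all $\tau$ in the sequence, where $(\sigma_\tau u)(t)=u(t+\tau)$. Then, if $p<\infty$, $(u_\tau)$ is relatively compact in $L^p(0,T;B)$. If $p=\infty$ and $\tau\to 0$ along the sequence, there is a subsequence of $(u_\tau)$ that converges in $L^q(0,T;B)$ for all $1\le q<\infty$ to one limit function, which belongs to $C^0([0,T];B)$. -/

import Mathlib

open MeasureTheory Filter Topology Set
open scoped ENNReal

/-- A seminormed nonnegative cone `M₊` in a Banach space `B`: a subset stable under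
multiplication by nonnegative reals, with a function `[·] : M₊ → [0, ∞)` that vanishes exactly
at `0` and is positively homogeneous.  Neither convexity of the set nor a triangle inequality is
required.  Only the values of `seminorm` on `carrier` matter. -/
structure SeminormedCone (B : Type*) [NormedAddCommGroup B] [NormedSpace ℝ B] where
  /-- the set `M₊` -/
  carrier : Set B
  /-- the function `[·]` -/
  seminorm : B → ℝ
  smul_mem : ∀ u ∈ carrier, ∀ c : ℝ, 0 ≤ c → c • u ∈ carrier
  seminorm_nonneg : ∀ u ∈ carrier, 0 ≤ seminorm u
  seminorm_eq_zero_iff : ∀ u ∈ carrier, (seminorm u = 0 ↔ u = 0)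
  seminorm_smul : ∀ u ∈ carrier, ∀ c : ℝ, 0 ≤ c → seminorm (c • u) = c * seminorm u

/-- `M₊ ↪ B` compactly: every sequence that is bounded in `M₊` has a subsequence converging
in `B`. -/
def SeminormedCone.CompactlyEmbedded {B : Type*} [NormedAddCommGroup B] [NormedSpace ℝ B]
    (M : SeminormedCone B) : Prop :=
  ∀ w : ℕ → B, (∀ n, w n ∈ M.carrier) → (∃ K : ℝ, ∀ n, M.seminorm (w n) ≤ K) →
    ∃ φ : ℕ → ℕ, StrictMono φ ∧ ∃ l : B, Tendsto (fun n => w (φ n)) atTop (𝓝 l)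

/-- `u` is constant on each of the intervals `((k - 1) τ, k τ]`, `1 ≤ k ≤ N`. -/
def IsPiecewiseConstant {E : Type*} (τ : ℝ) (N : ℕ) (u : ℝ → E) : Prop :=
  ∀ k : ℕ, 1 ≤ k → k ≤ N →
    ∀ s ∈ Ioc (((k : ℝ) - 1) * τ) (k * τ), ∀ t ∈ Ioc (((k : ℝ) - 1) * τ) (k * τ), u s = u t

/-- Lebesgue measure on the interval `(0, T)`. -/
noncomputable def timeMeasure (T : ℝ) : Measure ℝ := volume.restrict (Ioo 0 T)

/-- The functions `u n` converge to `f` in `L^q(0, T; B)`. -/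
def ConvergesInLq {B : Type*} [NormedAddCommGroup B] (q : ℝ≥0∞) (T : ℝ)
    (u : ℕ → ℝ → B) (f : ℝ → B) : Prop :=
  (∀ n, MemLp (u n) q (timeMeasure T)) ∧ MemLp f q (timeMeasure T) ∧
    Tendsto (fun n => eLpNorm (fun t => u n t - f t) q (timeMeasure T)) atTop (𝓝 0)

/-!
The proof transfers the control of the jumps from the weak space `Y` to `B` by an Ehrling type
inequality and then approximates by functions on a fixed grid.

* For every `ε > 0` there is `D` such that
  `‖w₁ - w₂‖_B ≤ ε ([w₁] + [w₂]) + D ‖w₁ - w₂‖_Y` for `w₁, w₂` in the cone whose difference lies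
  in `Y` (`SeminormedCone.CompactlyEmbedded.exists_norm_sub_le`).  The cone need not be convex, so
  the inequality concerns differences of two elements and not elements of a linear space.
* The bound on the time shift says that the jumps of `u_τ`, measured in `Y`, satisfy
  `∑_{i ≤ k < j} ‖jump k‖ ≤ C ((j - i) τ) ^ (1 - 1/r)`.  The partial sums of the jumps form a
  monotone function `V` that dominates the increments of `u_τ` in `Y`
  (`exists_monotone_variation`).  For `r = 1` its total increment is at most `C`; for `r > 1` it
  is Hölder continuous up to the step size.

For `p < ∞` divide `(0, T]` into equal intervals of length `σ`, independent of `τ`, and in each of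
them choose a point at which `[u_τ]` does not exceed its `L^p` mean.  The step function built from
the values at these points takes its values in a bounded part of the cone, which is relatively
compact in `B`, so these step functions lie in a compact subset of `L^p`.  By the Ehrling
inequality the distance of `u_τ` to its step function is at most
`2 ε K + D C σ ^ (1/p)` (`exists_stepFunction_approx`), because the oscillations of `V` over the
intervals sum up to at most `C`.  Hence the family is totally bounded
(`totallyBounded_range_toLp`).  No convexity of the cone, no averaging and no limit `τ → 0` is
needed.

For `p = ∞` all values of `u_τ` lie in one compact set, and the Ehrling inequality makes the
family equicontinuous up to an error that vanishes with `τ`.  An Arzelà–Ascoli argument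
(`exists_subseq_tendsto_of_asymptotically_equicontinuous`) gives a subsequence that converges
pointwise to a continuous function, and dominated convergence gives convergence in `L^q`.
-/

/-! ### Uniform grids on a half-line -/

/-- The `k`-th cell `(kτ, (k+1)τ]` of the grid of step `τ`; cells are numbered from `0`. -/
def gridCell (τ : ℝ) (k : ℕ) : Set ℝ := Ioc (k * τ) ((k + 1) * τ)

/-- The index of the cell of the grid of step `τ` that contains `t`, for `t > 0`.  By truncated
subtraction it is `0` for `t ≤ 0`, so that it is monotone on the whole line. -/
noncomputable def cellIndex (τ t : ℝ) : ℕ := ⌈t / τ⌉₊ - 1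

section Grid

variable {τ t : ℝ}

theorem mem_gridCell_cellIndex (hτ : 0 < τ) (ht : 0 < t) : t ∈ gridCell τ (cellIndex τ t) := by
  have h1 : 0 < ⌈t / τ⌉₊ := Nat.ceil_pos.2 (div_pos ht hτ)
  have h2 : ((cellIndex τ t : ℕ) : ℝ) + 1 = (⌈t / τ⌉₊ : ℝ) := by
    have : cellIndex τ t + 1 = ⌈t / τ⌉₊ := by unfold cellIndex; omega
    exact_mod_cast this
  refine ⟨?_, ?_⟩
  · rw [← lt_div_iff₀ hτ]
    have := Nat.ceil_lt_add_one (div_pos ht hτ).le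
    linarith
  · rw [← div_le_iff₀ hτ, h2]
    exact Nat.le_ceil _

theorem cellIndex_eq_of_mem (hτ : 0 < τ) {k : ℕ} (h : t ∈ gridCell τ k) : cellIndex τ t = k := by
  have : ⌈t / τ⌉₊ = k + 1 := by
    rw [Nat.ceil_eq_iff (Nat.succ_ne_zero k)]
    refine ⟨?_, ?_⟩
    · simpa using (lt_div_iff₀ hτ).2 h.1
    · push_cast
      exact (div_le_iff₀ hτ).2 h.2
  unfold cellIndex
  omega

theorem cellIndex_mono (hτ : 0 < τ) : Monotone (cellIndex τ) := fun _ _ h =>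
  Nat.sub_le_sub_right (Nat.ceil_mono (div_le_div_of_nonneg_right h hτ.le)) 1

theorem cellIndex_zero : cellIndex τ 0 = 0 := by simp [cellIndex]

theorem cellIndex_mul_le (hτ : 0 < τ) (ht : 0 ≤ t) : cellIndex τ t * τ ≤ t := by
  rcases ht.eq_or_lt with rfl | ht
  · simp [cellIndex_zero]
  · exact (mem_gridCell_cellIndex hτ ht).1.le

theorem le_cellIndex_add_one_mul (hτ : 0 < τ) (ht : 0 ≤ t) : t ≤ (cellIndex τ t + 1) * τ := by
  rcases ht.eq_or_lt with rfl | ht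
  · positivity
  · exact (mem_gridCell_cellIndex hτ ht).2

theorem cellIndex_lt (hτ : 0 < τ) {N : ℕ} (hN : 0 < N) (ht : t ≤ N * τ) : cellIndex τ t < N := by
  have : ⌈t / τ⌉₊ ≤ N := Nat.ceil_le.2 ((div_le_iff₀ hτ).2 ht)
  unfold cellIndex
  omega

theorem stronglyMeasurable_comp_cellIndex {E : Type*} [TopologicalSpace E] (g : ℕ → E) :
    StronglyMeasurable fun t => g (cellIndex τ t) := by
  have h : Measurable (cellIndex τ) :=
    (Measurable.of_discrete (f := fun n : ℕ => n - 1)).comp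
      (Nat.measurable_ceil.comp (measurable_id.div_const τ))
  exact (StronglyMeasurable.of_discrete (f := g)).comp_measurable h

theorem gridCell_subset_Ioc (hτ : 0 < τ) {N k : ℕ} (hk : k < N) :
    gridCell τ k ⊆ Ioc 0 (N * τ) := by
  refine Ioc_subset_Ioc (by positivity) (mul_le_mul_of_nonneg_right ?_ hτ.le)
  exact_mod_cast hk

theorem measurableSet_gridCell {k : ℕ} : MeasurableSet (gridCell τ k) := measurableSet_Ioc

theorem volume_gridCell (τ : ℝ) (k : ℕ) : volume (gridCell τ k) = ENNReal.ofReal τ := by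
  rw [gridCell, Real.volume_Ioc]
  congr 1
  ring

theorem timeMeasure_eq_restrict_Ioc (T : ℝ) : timeMeasure T = volume.restrict (Ioc 0 T) :=
  Measure.restrict_congr_set Ioo_ae_eq_Ioc

theorem ae_timeMeasure_mem (T : ℝ) : ∀ᵐ t ∂timeMeasure T, t ∈ Ioc 0 T := by
  rw [timeMeasure_eq_restrict_Ioc]
  exact ae_restrict_mem measurableSet_Ioc

instance isFiniteMeasure_timeMeasure (T : ℝ) : IsFiniteMeasure (timeMeasure T) := by
  unfold timeMeasure
  infer_instance

theorem setLIntegral_Ioc_eq_sum_gridCell (hτ : 0 < τ) (f : ℝ → ℝ≥0∞) {i j : ℕ} (hij : i ≤ j) :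
    ∫⁻ t in Ioc (i * τ) (j * τ), f t = ∑ k ∈ Finset.Ico i j, ∫⁻ t in gridCell τ k, f t := by
  induction j, hij using Nat.le_induction with
  | base => simp
  | succ j hij ih =>
    have h1 : (i : ℝ) * τ ≤ j * τ := by gcongr
    have h2 : (j : ℝ) * τ ≤ (j + 1) * τ := by gcongr; linarith
    rw [Finset.sum_Ico_succ_top hij, ← ih, gridCell, ← lintegral_union measurableSet_Ioc,
      Ioc_union_Ioc_eq_Ioc h1 h2]
    · push_cast
      rfl
    · exact Ioc_disjoint_Ioc_of_le le_rfl

theorem lintegral_timeMeasure_eq_sum_gridCell (hτ : 0 < τ) (f : ℝ → ℝ≥0∞) (N : ℕ) :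
    ∫⁻ t, f t ∂timeMeasure (N * τ) = ∑ k ∈ Finset.range N, ∫⁻ t in gridCell τ k, f t := by
  have := setLIntegral_Ioc_eq_sum_gridCell hτ f (Nat.zero_le N)
  rw [Nat.cast_zero, zero_mul] at this
  rw [timeMeasure_eq_restrict_Ioc, this, Finset.range_eq_Ico]

theorem setLIntegral_gridCell_comp_cellIndex (hτ : 0 < τ) (g : ℕ → ℝ≥0∞) (k : ℕ) :
    ∫⁻ t in gridCell τ k, g (cellIndex τ t) = g k * ENNReal.ofReal τ := by
  have h : EqOn (fun t => g (cellIndex τ t)) (fun _ => g k) (gridCell τ k) := fun t ht => by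
    simp only [cellIndex_eq_of_mem hτ ht]
  rw [setLIntegral_congr_fun measurableSet_gridCell h, setLIntegral_const, volume_gridCell]

end Grid

/-! ### Piecewise constant functions -/

section PiecewiseConstant

variable {τ : ℝ} {N : ℕ}

/-- On `(0, Nτ]` a piecewise constant function is a function of the cell index, namely its value
at the right end of the cell. -/
theorem IsPiecewiseConstant.eq_comp_cellIndex {E : Type*} {u : ℝ → E}
    (hu : IsPiecewiseConstant τ N u) (hτ : 0 < τ) (hN : 0 < N) {t : ℝ} (ht : t ∈ Ioc 0 (N * τ)) :
    u t = u ((cellIndex τ t + 1) * τ) := by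
  have hk := cellIndex_lt hτ hN ht.2
  have hmem := mem_gridCell_cellIndex hτ ht.1
  refine hu (cellIndex τ t + 1) (by omega) (by omega) t ?_ _ ?_
  · simpa [gridCell] using hmem
  · push_cast
    constructor <;> nlinarith

theorem one_sub_one_div_toReal_nonneg {r : ℝ≥0∞} (hr : 1 ≤ r) : 0 ≤ 1 - 1 / r.toReal := by
  rcases eq_or_ne r ∞ with rfl | hr'
  · simp
  · have : 1 ≤ r.toReal := by
      simpa using (ENNReal.toReal_le_toReal ENNReal.one_ne_top hr').2 hr
    have := (div_le_one (by linarith)).2 this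
    linarith

/-- The bound on the time shift in `L^r`, combined with Hölder's inequality, bounds the sum of
consecutive jumps by a power of the length of the time interval in which they occur. -/
theorem sum_jumps_le {Y : Type*} [NormedAddCommGroup Y] {v : ℝ → Y} {a : ℕ → Y} (hτ : 0 < τ)
    (hva : ∀ t ∈ Ioc 0 (N * τ), v t = a (cellIndex τ t)) {r : ℝ≥0∞} (hr : 1 ≤ r)
    {C : ℝ} (hC : 0 < C)
    (hshift : eLpNorm (fun t => v (t + τ) - v t) r (timeMeasure (N * τ - τ))
        ≤ ENNReal.ofReal (C * τ)) {i j : ℕ} (hij : i ≤ j) (hj : j < N) :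
    ∑ k ∈ Finset.Ico i j, ‖a (k + 1) - a k‖ ≤ C * (((j : ℝ) - i) * τ) ^ (1 - 1 / r.toReal) := by
  have hij' : (0 : ℝ) ≤ (j : ℝ) - i := sub_nonneg.2 (by exact_mod_cast hij)
  have hexp := one_sub_one_div_toReal_nonneg hr
  have hjN : (j : ℝ) * τ ≤ N * τ - τ := by
    have : (j : ℝ) + 1 ≤ N := by exact_mod_cast hj
    nlinarith
  set μ : Measure ℝ := volume.restrict (Ioc (i * τ) (j * τ)) with hμ
  set g : ℝ → Y := fun t => a (cellIndex τ t + 1) - a (cellIndex τ t) with hg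
  have hgm : AEStronglyMeasurable g μ :=
    (stronglyMeasurable_comp_cellIndex fun k => a (k + 1) - a k).aestronglyMeasurable
  have hgv : g =ᵐ[μ] fun t => v (t + τ) - v t := by
    filter_upwards [ae_restrict_mem measurableSet_Ioc] with t ht
    have h0 : 0 < t := lt_of_le_of_lt (by positivity) ht.1
    have hc := mem_gridCell_cellIndex hτ h0
    have hc' : t + τ ∈ gridCell τ (cellIndex τ t + 1) := by
      unfold gridCell at hc ⊢
      push_cast
      constructor <;> linarith [hc.1, hc.2]
    rw [hva t ⟨h0, by linarith [ht.2]⟩, hva (t + τ) ⟨by linarith, by linarith [ht.2]⟩,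
      cellIndex_eq_of_mem hτ hc']
  have hμle : μ ≤ timeMeasure (N * τ - τ) := by
    rw [timeMeasure_eq_restrict_Ioc]
    exact Measure.restrict_mono (Ioc_subset_Ioc (by positivity) hjN) le_rfl
  have h1 : eLpNorm g r μ ≤ ENNReal.ofReal (C * τ) := by
    rw [eLpNorm_congr_ae hgv]
    exact (eLpNorm_mono_measure _ hμle).trans hshift
  have h2 : eLpNorm g 1 μ = (∑ k ∈ Finset.Ico i j, ‖a (k + 1) - a k‖ₑ) * ENNReal.ofReal τ := by
    rw [eLpNorm_one_eq_lintegral_enorm, hμ, setLIntegral_Ioc_eq_sum_gridCell hτ _ hij,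
      Finset.sum_mul]
    exact Finset.sum_congr rfl fun k _ =>
      setLIntegral_gridCell_comp_cellIndex hτ (fun k => ‖a (k + 1) - a k‖ₑ) k
  -- Hölder's inequality between `L^1` and `L^r` on `(iτ, jτ]`; for `r = ∞` the exponent is `1`, as
  -- `1 / (∞).toReal = 0`.
  have h3 := (h2 ▸ eLpNorm_le_eLpNorm_mul_rpow_measure_univ hr hgm).trans (mul_le_mul_left h1 _)
  have hμu : μ univ = ENNReal.ofReal (((j : ℝ) - i) * τ) := by
    rw [hμ, Measure.restrict_apply_univ, Real.volume_Ioc]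
    congr 1
    ring
  simp only [ENNReal.toReal_one, div_one] at h3
  rw [hμu, ENNReal.ofReal_rpow_of_nonneg (by positivity) hexp, ← ENNReal.ofReal_mul (by positivity),
    Finset.sum_congr rfl fun k _ => (ofReal_norm (a (k + 1) - a k)).symm,
    ← ENNReal.ofReal_sum_of_nonneg (fun _ _ => norm_nonneg _),
    ← ENNReal.ofReal_mul (Finset.sum_nonneg fun _ _ => norm_nonneg _),
    ENNReal.ofReal_le_ofReal_iff (by positivity)] at h3
  refine le_of_mul_le_mul_right (h3.trans_eq ?_) hτ
  ring

/-- A piecewise constant function in `Y` whose time shift is bounded is controlled by a monotone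
function `V`, its variation, with a Hölder modulus of continuity up to the step size. -/
theorem exists_monotone_variation {Y : Type*} [NormedAddCommGroup Y] {v : ℝ → Y} (hτ : 0 < τ)
    (hN : 0 < N) (hv : IsPiecewiseConstant τ N v) {r : ℝ≥0∞} (hr : 1 ≤ r) {C : ℝ} (hC : 0 < C)
    (hshift : eLpNorm (fun t => v (t + τ) - v t) r (timeMeasure (N * τ - τ))
        ≤ ENNReal.ofReal (C * τ)) :
    ∃ V : ℝ → ℝ, Monotone V ∧
      (∀ s t, 0 < s → s ≤ t → t ≤ N * τ → ‖v t - v s‖ ≤ V t - V s) ∧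
      ∀ s t, 0 ≤ s → s ≤ t → t ≤ N * τ →
        V t - V s ≤ C * (t - s + τ) ^ (1 - 1 / r.toReal) := by
  set a : ℕ → Y := fun k => v ((k + 1) * τ) with ha
  have hva : ∀ t ∈ Ioc 0 (N * τ), v t = a (cellIndex τ t) := fun t ht =>
    hv.eq_comp_cellIndex hτ hN ht
  set F : ℕ → ℝ := fun k => ∑ i ∈ Finset.range k, ‖a (i + 1) - a i‖ with hF
  have hFsub : ∀ i j, i ≤ j → F j - F i = ∑ k ∈ Finset.Ico i j, ‖a (k + 1) - a k‖ :=
    fun i j hij => (Finset.sum_Ico_eq_sub _ hij).symm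
  have hFmono : Monotone F := fun i j hij => by
    rw [← sub_nonneg, hFsub i j hij]
    exact Finset.sum_nonneg fun _ _ => norm_nonneg _
  refine ⟨fun t => F (cellIndex τ t), hFmono.comp (cellIndex_mono hτ), ?_, ?_⟩
  · intro s t hs hst ht
    dsimp only
    rw [hFsub _ _ (cellIndex_mono hτ hst), hva s ⟨hs, hst.trans ht⟩, hva t ⟨hs.trans_le hst, ht⟩,
      ← dist_eq_norm, dist_comm]
    refine (dist_le_Ico_sum_dist a (cellIndex_mono hτ hst)).trans_eq
      (Finset.sum_congr rfl fun k _ => ?_)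
    rw [dist_comm, dist_eq_norm]
  · intro s t hs hst ht
    dsimp only
    rw [hFsub _ _ (cellIndex_mono hτ hst)]
    refine (sum_jumps_le hτ hva hr hC hshift (cellIndex_mono hτ hst)
      (cellIndex_lt hτ hN ht)).trans (mul_le_mul_of_nonneg_left ?_ hC.le)
    have h1 := cellIndex_mul_le hτ (hs.trans hst)
    have h2 := le_cellIndex_add_one_mul hτ hs
    have h3 : (0 : ℝ) ≤ (cellIndex τ t : ℝ) - cellIndex τ s :=
      sub_nonneg.2 (by exact_mod_cast cellIndex_mono hτ hst)
    exact Real.rpow_le_rpow (by positivity) (by linarith) (one_sub_one_div_toReal_nonneg hr)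

end PiecewiseConstant

/-! ### Compactness of bounded sets of the cone and an Ehrling inequality -/

theorem isCompact_closure_of_subseq_tendsto {X : Type*} [PseudoMetricSpace X] {S : Set X}
    (hS : ∀ x : ℕ → X, (∀ n, x n ∈ S) →
      ∃ φ : ℕ → ℕ, StrictMono φ ∧ ∃ l, Tendsto (fun n => x (φ n)) atTop (𝓝 l)) :
    IsCompact (closure S) := by
  refine IsSeqCompact.isCompact fun x hx => ?_
  choose y hyS hy using fun n : ℕ =>
    Metric.mem_closure_iff.1 (hx n) (1 / ((n : ℝ) + 1)) Nat.one_div_pos_of_nat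
  obtain ⟨φ, hφ, l, hl⟩ := hS y hyS
  refine ⟨l, mem_closure_of_tendsto hl (Eventually.of_forall fun n => hyS _), φ, hφ, ?_⟩
  refine tendsto_of_tendsto_of_dist hl ?_
  refine squeeze_zero (fun _ => dist_nonneg) (fun n => ?_)
    (tendsto_one_div_add_atTop_nhds_zero_nat.comp hφ.tendsto_atTop)
  rw [dist_comm]
  exact (hy (φ n)).le

section Cone

variable {B Y V : Type*} [NormedAddCommGroup B] [NormedSpace ℝ B] {M : SeminormedCone B}

theorem SeminormedCone.CompactlyEmbedded.isCompact_closure_sublevel (hc : M.CompactlyEmbedded)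
    (R : ℝ) : IsCompact (closure {w | w ∈ M.carrier ∧ M.seminorm w ≤ R}) :=
  isCompact_closure_of_subseq_tendsto fun x hx =>
    hc x (fun n => (hx n).1) ⟨R, fun n => (hx n).2⟩

/-- An Ehrling type inequality for differences of elements of the cone.  Homogeneity allows to
normalise the two seminorms to have sum `1`, and then compactness of the embedding yields a
violation of the closedness hypothesis if the inequality fails for every constant. -/
theorem SeminormedCone.CompactlyEmbedded.exists_norm_sub_le [NormedAddCommGroup Y]
    [NormedSpace ℝ Y] [AddCommGroup V] [Module ℝ V] (hc : M.CompactlyEmbedded)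
    (iB : B →ₗ[ℝ] V) (iY : Y →ₗ[ℝ] V)
    (hclosed : ∀ (w : ℕ → B) (y : ℕ → Y) (w₀ : B), (∀ n, iB (w n) = iY (y n)) →
      Tendsto w atTop (𝓝 w₀) → Tendsto y atTop (𝓝 0) → w₀ = 0) {ε : ℝ} (hε : 0 < ε) :
    ∃ C : ℝ, 0 ≤ C ∧ ∀ w₁ ∈ M.carrier, ∀ w₂ ∈ M.carrier, ∀ y : Y, iB (w₁ - w₂) = iY y →
      ‖w₁ - w₂‖ ≤ ε * (M.seminorm w₁ + M.seminorm w₂) + C * ‖y‖ := by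
  by_contra! hcon
  choose a ha b hb y hy hlt using fun n : ℕ => hcon (n : ℝ) (Nat.cast_nonneg n)
  have hann := fun n => M.seminorm_nonneg _ (ha n)
  have hbnn := fun n => M.seminorm_nonneg _ (hb n)
  set s : ℕ → ℝ := fun n => M.seminorm (a n) + M.seminorm (b n) with hs
  -- If `s n = 0`, then `a n = b n = 0`, which the strict inequality `hlt n` excludes.
  have hspos : ∀ n, 0 < s n := fun n => by
    refine lt_of_le_of_ne (add_nonneg (hann n) (hbnn n)) fun h0 => ?_
    have h1 : a n = 0 := (M.seminorm_eq_zero_iff _ (ha n)).1 (by linarith [hann n, hbnn n])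
    have h2 : b n = 0 := (M.seminorm_eq_zero_iff _ (hb n)).1 (by linarith [hann n, hbnn n])
    have h3 := hlt n
    have h4 : 0 ≤ (n : ℝ) * ‖y n‖ := by positivity
    simp only [h1, h2, sub_self, norm_zero] at h3
    have h5 : M.seminorm (0 : B) = 0 := (M.seminorm_eq_zero_iff _ (h1 ▸ ha n)).2 rfl
    rw [h5] at h3
    linarith
  have hinv : ∀ n, 0 ≤ (s n)⁻¹ := fun n => (inv_pos.2 (hspos n)).le
  have ha' := fun n => M.smul_mem _ (ha n) _ (hinv n)
  have hb' := fun n => M.smul_mem _ (hb n) _ (hinv n)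
  obtain ⟨φ, hφ, l, hl⟩ := hc _ ha' ⟨1, fun n => by
    rw [M.seminorm_smul _ (ha n) _ (hinv n), inv_mul_le_iff₀ (hspos n)]
    linarith [hbnn n]⟩
  obtain ⟨ψ, hψ, l', hl'⟩ := hc (fun n => (s (φ n))⁻¹ • b (φ n)) (fun n => hb' _) ⟨1, fun n => by
    rw [M.seminorm_smul _ (hb _) _ (hinv _), inv_mul_le_iff₀ (hspos _)]
    linarith [hann (φ n)]⟩
  set θ : ℕ → ℕ := φ ∘ ψ with hθ
  have hθm : StrictMono θ := hφ.comp hψ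
  have hlim : Tendsto (fun n => (s (θ n))⁻¹ • (a (θ n) - b (θ n))) atTop (𝓝 (l - l')) := by
    simp only [smul_sub]
    exact (hl.comp hψ.tendsto_atTop).sub hl'
  have hlow : ∀ n, ε + n * ‖(s n)⁻¹ • y n‖ < ‖(s n)⁻¹ • (a n - b n)‖ := fun n => by
    rw [norm_smul, norm_smul, Real.norm_of_nonneg (hinv n)]
    have := mul_lt_mul_of_pos_left (hlt n) (inv_pos.2 (hspos n))
    refine lt_of_eq_of_lt ?_ this
    have hne := (hspos n).ne'
    change _ = (s n)⁻¹ * (ε * s n + n * ‖y n‖)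
    field_simp
  obtain ⟨K, hK⟩ := hlim.norm.bddAbove_range
  have hyz : Tendsto (fun n => (s (θ n))⁻¹ • y (θ n)) atTop (𝓝 0) := by
    refine squeeze_zero_norm' ?_
      ((tendsto_const_div_atTop_nhds_zero_nat K).comp hθm.tendsto_atTop)
    filter_upwards [eventually_gt_atTop 0] with n hn
    have hpos : (0 : ℝ) < θ n := by exact_mod_cast hn.trans_le (hθm.id_le n)
    rw [Function.comp_apply, le_div_iff₀ hpos]
    have h1 := hlow (θ n)
    have h2 := hK (mem_range_self n)
    linarith
  have h0 := hclosed _ _ _ (fun n => by rw [map_smul, map_smul, hy]) hlim hyz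
  rw [h0] at hlim
  have : ε ≤ ‖(0 : B)‖ := ge_of_tendsto hlim.norm (Eventually.of_forall fun n => by
    have h1 := hlow (θ n)
    have : 0 ≤ (θ n : ℝ) * ‖(s (θ n))⁻¹ • y (θ n)‖ := by positivity
    linarith)
  rw [norm_zero] at this
  linarith

end Cone

/-! ### A selection principle of Arzelà–Ascoli type -/

/-- The functions `g n` need not be continuous; they are only equicontinuous up to an error that
vanishes as `n → ∞`. -/
theorem exists_subseq_tendsto_of_asymptotically_equicontinuous {X E : Type*} [PseudoMetricSpace X]
    [TopologicalSpace.SeparableSpace X] [MetricSpace E] {Q : Set E} (hQ : IsCompact Q)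
    {g : ℕ → X → E} (hgQ : ∀ n x, g n x ∈ Q)
    (hg : ∀ ε > 0, ∃ δ > 0, ∀ᶠ n in atTop, ∀ x y, dist x y < δ → dist (g n x) (g n y) ≤ ε) :
    ∃ φ : ℕ → ℕ, StrictMono φ ∧ ∃ f : X → E, Continuous f ∧
      ∀ x, Tendsto (fun n => g (φ n) x) atTop (𝓝 (f x)) := by
  obtain ⟨D, hDc, hD⟩ := TopologicalSpace.exists_countable_dense X
  have : Countable D := hDc
  -- A diagonal subsequence, provided by sequential compactness of the countable product `Q ^ D`.
  obtain ⟨_, -, φ, hφ, hl⟩ := (isCompact_univ_pi fun _ : D => hQ).isSeqCompact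
    (x := fun n d => g n d) fun n => mem_univ_pi.2 fun d => hgQ n d
  rw [tendsto_pi_nhds] at hl
  have hcauchy : ∀ x, CauchySeq fun n => g (φ n) x := fun x => by
    refine Metric.cauchySeq_iff'.2 fun ε hε => ?_
    obtain ⟨δ, hδ, hev⟩ := hg (ε / 8) (by positivity)
    obtain ⟨d, hdD, hd⟩ := hD.exists_dist_lt x hδ
    obtain ⟨n₁, h₁⟩ := eventually_atTop.1 (hφ.tendsto_atTop.eventually hev)
    obtain ⟨n₂, h₂⟩ := Metric.cauchySeq_iff.1 (hl ⟨d, hdD⟩).cauchySeq (ε / 8) (by positivity)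
    refine ⟨max n₁ n₂, fun n hn => ?_⟩
    have e1 := h₁ n ((le_max_left _ _).trans hn) x d hd
    have e2 := h₁ (max n₁ n₂) (le_max_left _ _) x d hd
    have e3 := h₂ n ((le_max_right _ _).trans hn) (max n₁ n₂) (le_max_right _ _)
    have e4 := dist_triangle4 (g (φ n) x) (g (φ n) d) (g (φ (max n₁ n₂)) d) (g (φ (max n₁ n₂)) x)
    rw [dist_comm (g (φ (max n₁ n₂)) d)] at e4
    simp only [Function.comp_apply] at e3
    linarith
  have hlim : ∀ x, ∃ l, Tendsto (fun n => g (φ n) x) atTop (𝓝 l) := fun x => by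
    obtain ⟨l, -, hl⟩ := cauchySeq_tendsto_of_isComplete hQ.isComplete
      (fun n => hgQ (φ n) x) (hcauchy x)
    exact ⟨l, hl⟩
  choose f hf using hlim
  refine ⟨φ, hφ, f, ?_, hf⟩
  refine Metric.continuous_iff.2 fun x ε hε => ?_
  obtain ⟨δ, hδ, hev⟩ := hg (ε / 2) (by positivity)
  refine ⟨δ, hδ, fun y hy => lt_of_le_of_lt ?_ (half_lt_self hε)⟩
  refine le_of_tendsto ((hf y).dist (hf x)) ?_
  filter_upwards [hφ.tendsto_atTop.eventually hev] with n hn using hn y x hy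

/-! ### Total boundedness in `L^p` -/

section StepFunction

variable {E : Type*} {τ : ℝ} {m : ℕ}

/-- The function that takes the value `b j` on the `j`-th cell of the grid of step `τ`,
`0 ≤ j ≤ m`.  Beyond the last cell the values recur cyclically. -/
noncomputable def stepFunction (τ : ℝ) (b : Fin (m + 1) → E) (t : ℝ) : E :=
  b (Fin.ofNat (m + 1) (cellIndex τ t))

theorem stronglyMeasurable_stepFunction [TopologicalSpace E] (b : Fin (m + 1) → E) :
    StronglyMeasurable (stepFunction τ b) :=
  stronglyMeasurable_comp_cellIndex fun k => b (Fin.ofNat (m + 1) k)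

theorem memLp_stepFunction [NormedAddCommGroup E] (b : Fin (m + 1) → E) (p : ℝ≥0∞) (T : ℝ) :
    MemLp (stepFunction τ b) p (timeMeasure T) :=
  MemLp.of_bound (stronglyMeasurable_stepFunction b).aestronglyMeasurable ‖b‖
    (Eventually.of_forall fun _ => norm_le_pi_norm b _)

theorem totallyBounded_stepFunctions [NormedAddCommGroup E] {Q : Set E} (hQ : IsCompact Q)
    (p : ℝ≥0∞) [Fact (1 ≤ p)] (T : ℝ) :
    TotallyBounded ((fun b : Fin (m + 1) → E => (memLp_stepFunction (τ := τ) b p T).toLp) ''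
      univ.pi fun _ => Q) := by
  refine (isCompact_univ_pi fun _ => hQ).totallyBounded.image ?_
  have hD : timeMeasure T univ ^ p.toReal⁻¹ ≠ ∞ :=
    ENNReal.rpow_ne_top_of_nonneg (by positivity) (measure_ne_top _ _)
  refine (LipschitzWith.uniformContinuous
    (K := (timeMeasure T univ ^ p.toReal⁻¹).toNNReal) fun b b' => ?_)
  rw [Lp.edist_toLp_toLp, ENNReal.coe_toNNReal hD, edist_dist]
  refine eLpNorm_le_of_ae_bound (Eventually.of_forall fun t => ?_)
  rw [dist_eq_norm]
  exact norm_le_pi_norm (b - b') _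

end StepFunction

theorem totallyBounded_of_forall_exists_approx {X : Type*} [PseudoMetricSpace X] {A : Set X}
    (h : ∀ ε > 0, ∃ S : Set X, TotallyBounded S ∧ ∀ x ∈ A, ∃ y ∈ S, dist x y ≤ ε) :
    TotallyBounded A := by
  refine Metric.totallyBounded_iff.2 fun ε hε => ?_
  obtain ⟨S, hS, hA⟩ := h (ε / 2) (by positivity)
  obtain ⟨t, ht, hSt⟩ := Metric.totallyBounded_iff.1 hS (ε / 2) (by positivity)
  refine ⟨t, ht, fun x hx => ?_⟩
  obtain ⟨y, hy, hxy⟩ := hA x hx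
  obtain ⟨z, hz, hyz⟩ := mem_iUnion₂.1 (hSt hy)
  refine mem_iUnion₂.2 ⟨z, hz, Metric.mem_ball.2 ?_⟩
  linarith [dist_triangle x y z, Metric.mem_ball.1 hyz]

theorem exists_mem_gridCell_mul_le_setLIntegral {σ : ℝ} (hσ : 0 < σ) {N : ℕ} {f : ℝ → ℝ≥0∞}
    (hf : AEMeasurable f (timeMeasure (N * σ))) :
    ∃ x : ℕ → ℝ, ∀ k < N, x k ∈ gridCell σ k ∧
      f (x k) * ENNReal.ofReal σ ≤ ∫⁻ t in gridCell σ k, f t := by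
  have hσ0 : ENNReal.ofReal σ ≠ 0 := (ENNReal.ofReal_pos.2 hσ).ne'
  have h : ∀ k, ∃ x, k < N → x ∈ gridCell σ k ∧
      f x * ENNReal.ofReal σ ≤ ∫⁻ t in gridCell σ k, f t := fun k => by
    by_cases hk : k < N
    · have hf' : AEMeasurable f (volume.restrict (gridCell σ k)) := by
        rw [timeMeasure_eq_restrict_Ioc] at hf
        exact hf.mono_measure (Measure.restrict_mono (gridCell_subset_Ioc hσ hk) le_rfl)
      obtain ⟨x, hx, hle⟩ := exists_le_setLAverage (by rwa [volume_gridCell])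
        (by rw [volume_gridCell]; exact ENNReal.ofReal_ne_top) hf'
      refine ⟨x, fun _ => ⟨hx, ?_⟩⟩
      rw [setLAverage_eq, volume_gridCell] at hle
      exact (ENNReal.le_div_iff_mul_le (Or.inl hσ0) (Or.inl ENNReal.ofReal_ne_top)).1 hle
    · exact ⟨0, fun h => absurd h hk⟩
  choose x hx using h
  exact ⟨x, hx⟩

/-- The oscillations `V ((k + 1) σ) - V (k σ)` of a monotone function over the cells of a grid sum
up to at most `C`, so that the step function of these oscillations is small in `L^p` for `p < ∞`
when the grid is fine. -/
theorem eLpNorm_oscillation_le {σ : ℝ} (hσ : 0 < σ) {N : ℕ} {V : ℝ → ℝ} (hV : Monotone V) {C : ℝ}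
    (hVC : V (N * σ) - V 0 ≤ C) {p : ℝ≥0∞} (hp : 1 ≤ p) (hp' : p ≠ ∞) :
    eLpNorm (fun t => V ((cellIndex σ t + 1) * σ) - V (cellIndex σ t * σ)) p
        (timeMeasure (N * σ)) ≤ ENNReal.ofReal (C * σ ^ (1 / p.toReal)) := by
  have hC : 0 ≤ C := (sub_nonneg.2 (hV (by positivity))).trans hVC
  have hp1 : 1 ≤ p.toReal := by
    simpa using (ENNReal.toReal_le_toReal ENNReal.one_ne_top hp').2 hp
  have hp0 : 0 < p.toReal := by linarith
  set d : ℕ → ℝ := fun k => V ((k + 1) * σ) - V (k * σ) with hd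
  have hdnn : ∀ k, 0 ≤ d k := fun k => sub_nonneg.2 (hV (by gcongr; linarith))
  have hsum : ∑ k ∈ Finset.range N, d k ≤ C := by
    refine le_trans (le_of_eq ?_) hVC
    simpa only [Nat.cast_add, Nat.cast_one, Nat.cast_zero, zero_mul] using
      Finset.sum_range_sub (fun k : ℕ => V (k * σ)) N
  have hdC : ∀ k ∈ Finset.range N, d k ≤ C := fun k hk =>
    (Finset.single_le_sum (fun i _ => hdnn i) hk).trans hsum
  rw [eLpNorm_eq_lintegral_rpow_enorm_toReal (zero_lt_one.trans_le hp).ne' hp',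
    lintegral_timeMeasure_eq_sum_gridCell hσ]
  have h1 : ∀ k ∈ Finset.range N,
      ∫⁻ t in gridCell σ k, ‖d (cellIndex σ t)‖ₑ ^ p.toReal ≤
        ENNReal.ofReal (d k * C ^ (p.toReal - 1) * σ) := fun k hk => by
    rw [setLIntegral_gridCell_comp_cellIndex hσ (fun k => ‖d k‖ₑ ^ p.toReal) k,
      Real.enorm_eq_ofReal (hdnn k), ENNReal.ofReal_rpow_of_nonneg (hdnn k) hp0.le,
      ← ENNReal.ofReal_mul (by have := hdnn k; positivity)]
    refine ENNReal.ofReal_le_ofReal (mul_le_mul_of_nonneg_right ?_ hσ.le)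
    -- One factor `d k` is kept for the sum, the others are bounded by `C`.
    have h2 : d k ^ p.toReal = d k * d k ^ (p.toReal - 1) := by
      have := Real.rpow_add_of_nonneg (hdnn k) zero_le_one (sub_nonneg.2 hp1)
      rwa [add_sub_cancel, Real.rpow_one] at this
    rw [h2]
    exact mul_le_mul_of_nonneg_left
      (Real.rpow_le_rpow (hdnn k) (hdC k hk) (sub_nonneg.2 hp1)) (hdnn k)
  have h3 : C * C ^ (p.toReal - 1) = C ^ p.toReal := by
    have := Real.rpow_add_of_nonneg hC zero_le_one (sub_nonneg.2 hp1)
    rwa [add_sub_cancel, Real.rpow_one, eq_comm] at this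
  have h4 : ∑ k ∈ Finset.range N, ∫⁻ t in gridCell σ k, ‖d (cellIndex σ t)‖ₑ ^ p.toReal ≤
      ENNReal.ofReal (C ^ p.toReal * σ) := by
    refine (Finset.sum_le_sum h1).trans ?_
    rw [← ENNReal.ofReal_sum_of_nonneg
      (fun k _ => by have := hdnn k; positivity), ← Finset.sum_mul, ← Finset.sum_mul]
    refine ENNReal.ofReal_le_ofReal (mul_le_mul_of_nonneg_right ?_ hσ.le)
    rw [← h3]
    exact mul_le_mul_of_nonneg_right hsum (by positivity)
  refine (ENNReal.rpow_le_rpow h4 (by positivity)).trans_eq ?_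
  rw [ENNReal.ofReal_rpow_of_nonneg (by positivity) (by positivity),
    Real.mul_rpow (by positivity) hσ.le, ← Real.rpow_mul hC, mul_one_div_cancel hp0.ne',
    Real.rpow_one]

/-- One sample per cell, taken where `h` does not exceed its `L^p` mean over the cell, gives a step
function that is `L^p`-close to `u`. -/
theorem exists_stepFunction_approx {E : Type*} [NormedAddCommGroup E] {m : ℕ} {σ : ℝ} (hσ : 0 < σ)
    {p : ℝ≥0∞} (hp : 1 ≤ p) (hp' : p ≠ ∞) {u : ℝ → E} {h V : ℝ → ℝ} {K C D ε : ℝ} (hK : 0 ≤ K)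
    (hε : 0 ≤ ε) (hD : 0 ≤ D)
    (hm : AEStronglyMeasurable h (timeMeasure ((m + 1 : ℕ) * σ)))
    (hnn : ∀ t ∈ Ioc 0 ((m + 1 : ℕ) * σ), 0 ≤ h t)
    (hhK : eLpNorm h p (timeMeasure ((m + 1 : ℕ) * σ)) ≤ ENNReal.ofReal K) (hV : Monotone V)
    (hVC : V ((m + 1 : ℕ) * σ) - V 0 ≤ C)
    (huV : ∀ s t, 0 < s → s ≤ t → t ≤ (m + 1 : ℕ) * σ →
      ‖u t - u s‖ ≤ ε * (h t + h s) + D * (V t - V s)) :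
    ∃ x : Fin (m + 1) → ℝ, (∀ j, x j ∈ Ioc 0 ((m + 1 : ℕ) * σ) ∧
        h (x j) ≤ K / σ ^ (1 / p.toReal)) ∧
      eLpNorm (u - stepFunction σ fun j => u (x j)) p (timeMeasure ((m + 1 : ℕ) * σ)) ≤
        ENNReal.ofReal (2 * ε * K + D * (C * σ ^ (1 / p.toReal))) := by
  have hp0 : p ≠ 0 := (zero_lt_one.trans_le hp).ne'
  have hpr : 0 < p.toReal := ENNReal.toReal_pos hp0 hp'
  have hC : 0 ≤ C := (sub_nonneg.2 (hV (by positivity))).trans hVC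
  set μ := timeMeasure ((m + 1 : ℕ) * σ) with hμ
  obtain ⟨x, hx⟩ := exists_mem_gridCell_mul_le_setLIntegral hσ
    (f := fun t => ‖h t‖ₑ ^ p.toReal) (hm.enorm.pow_const _)
  have hxmem : ∀ k < m + 1, x k ∈ Ioc 0 ((m + 1 : ℕ) * σ) := fun k hk =>
    gridCell_subset_Ioc hσ hk (hx k hk).1
  set S : ℝ → ℝ := fun t => h (x (cellIndex σ t)) with hS
  set W : ℝ → ℝ := fun t => V ((cellIndex σ t + 1) * σ) - V (cellIndex σ t * σ) with hW
  have hSm : AEStronglyMeasurable S μ :=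
    (stronglyMeasurable_comp_cellIndex fun k => h (x k)).aestronglyMeasurable
  have hWm : AEStronglyMeasurable W μ :=
    (stronglyMeasurable_comp_cellIndex fun k : ℕ =>
      V ((k + 1) * σ) - V (k * σ)).aestronglyMeasurable
  have hSK : eLpNorm S p μ ≤ ENNReal.ofReal K := by
    refine le_trans ?_ hhK
    rw [eLpNorm_eq_lintegral_rpow_enorm_toReal hp0 hp',
      eLpNorm_eq_lintegral_rpow_enorm_toReal hp0 hp', hμ,
      lintegral_timeMeasure_eq_sum_gridCell hσ, lintegral_timeMeasure_eq_sum_gridCell hσ]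
    refine ENNReal.rpow_le_rpow (Finset.sum_le_sum fun k hk => ?_) (by positivity)
    rw [setLIntegral_gridCell_comp_cellIndex hσ (fun k => ‖h (x k)‖ₑ ^ p.toReal) k]
    exact (hx k (Finset.mem_range.1 hk)).2
  have hbound : ∀ k < m + 1, h (x k) ≤ K / σ ^ (1 / p.toReal) := fun k hk => by
    have h1 : ‖h (x k)‖ₑ ^ p.toReal * ENNReal.ofReal σ ≤ ENNReal.ofReal K ^ p.toReal := by
      refine (hx k hk).2.trans ?_
      rw [eLpNorm_eq_lintegral_rpow_enorm_toReal hp0 hp', one_div,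
        ENNReal.rpow_inv_le_iff hpr] at hhK
      refine le_trans (lintegral_mono' ?_ le_rfl) hhK
      rw [hμ, timeMeasure_eq_restrict_Ioc]
      exact Measure.restrict_mono (gridCell_subset_Ioc hσ hk) le_rfl
    have h0 := hnn _ (hxmem k hk)
    rw [Real.enorm_eq_ofReal h0, ENNReal.ofReal_rpow_of_nonneg h0 hpr.le,
      ENNReal.ofReal_rpow_of_nonneg hK hpr.le, ← ENNReal.ofReal_mul (by positivity),
      ENNReal.ofReal_le_ofReal_iff (by positivity)] at h1
    rw [le_div_iff₀ (by positivity), ← Real.rpow_le_rpow_iff (by positivity) hK hpr,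
      Real.mul_rpow h0 (by positivity), ← Real.rpow_mul hσ.le, one_div_mul_cancel hpr.ne',
      Real.rpow_one]
    exact h1
  have hptw : ∀ᵐ t ∂μ, ‖(u - stepFunction σ fun j : Fin (m + 1) => u (x j)) t‖ ≤
      ‖((ε • h + ε • S) + D • W) t‖ := by
    filter_upwards [ae_timeMeasure_mem ((m + 1 : ℕ) * σ)] with t ht
    have hk := cellIndex_lt hσ (Nat.succ_pos m) ht.2
    have hmem := mem_gridCell_cellIndex hσ ht.1
    have hstep : stepFunction σ (fun j : Fin (m + 1) => u (x j)) t = u (x (cellIndex σ t)) := by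
      simp only [stepFunction, Fin.val_ofNat, Nat.mod_eq_of_lt hk]
    obtain ⟨hxc, -⟩ := hx _ hk
    have hxI := hxmem _ hk
    rw [Pi.sub_apply, hstep]
    refine le_trans ?_ (Real.le_norm_self _)
    simp only [Pi.add_apply, Pi.smul_apply, smul_eq_mul, hS, hW]
    have hV1 := hV hxc.1.le
    have hV2 := hV hxc.2
    have hV3 := hV hmem.1.le
    have hV4 := hV hmem.2
    rcases le_total (x (cellIndex σ t)) t with hle | hle
    · refine (huV _ _ hxI.1 hle ht.2).trans ?_
      have := mul_le_mul_of_nonneg_left (show V t - V (x (cellIndex σ t)) ≤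
        V ((cellIndex σ t + 1) * σ) - V (cellIndex σ t * σ) by linarith) hD
      linarith
    · rw [norm_sub_rev]
      refine (huV _ _ ht.1 hle hxI.2).trans ?_
      have := mul_le_mul_of_nonneg_left (show V (x (cellIndex σ t)) - V t ≤
        V ((cellIndex σ t + 1) * σ) - V (cellIndex σ t * σ) by linarith) hD
      linarith
  refine ⟨fun j => x j, fun j => ⟨hxmem j j.2, hbound j j.2⟩, (eLpNorm_mono_ae hptw).trans ?_⟩
  refine (eLpNorm_add_le ((hm.const_smul ε).add (hSm.const_smul ε)) (hWm.const_smul D) hp).trans ?_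
  refine (add_le_add_left (eLpNorm_add_le (hm.const_smul ε) (hSm.const_smul ε) hp) _).trans ?_
  rw [eLpNorm_const_smul, eLpNorm_const_smul, eLpNorm_const_smul, Real.enorm_eq_ofReal hε,
    Real.enorm_eq_ofReal hD]
  refine (add_le_add (add_le_add (mul_le_mul_right hhK _) (mul_le_mul_right hSK _))
    (mul_le_mul_right (eLpNorm_oscillation_le hσ hV hVC hp hp') _)).trans_eq ?_
  rw [← ENNReal.ofReal_mul hε, ← ENNReal.ofReal_mul hD,
    ← ENNReal.ofReal_add (by positivity) (by positivity),
    ← ENNReal.ofReal_add (by positivity) (by positivity)]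
  congr 1
  ring

/-- The compactness criterion behind the case `p < ∞`.  The functional `h i` plays the part of
the seminorm of `u i`, and `V i` that of the variation of `u i` in the weak norm. -/
theorem totallyBounded_range_toLp {E ι : Type*} [NormedAddCommGroup E] {p : ℝ≥0∞} [Fact (1 ≤ p)]
    (hp' : p ≠ ∞) {T : ℝ} (hT : 0 < T) {u : ι → ℝ → E} (hu : ∀ i, MemLp (u i) p (timeMeasure T))
    {h V : ι → ℝ → ℝ} {K C : ℝ} (hK : 0 ≤ K)
    (hm : ∀ i, AEStronglyMeasurable (h i) (timeMeasure T))
    (hnn : ∀ i, ∀ t ∈ Ioc 0 T, 0 ≤ h i t)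
    (hhK : ∀ i, eLpNorm (h i) p (timeMeasure T) ≤ ENNReal.ofReal K)
    (hcomp : ∀ R : ℝ, ∃ Q : Set E, IsCompact Q ∧ ∀ i, ∀ t ∈ Ioc 0 T, h i t ≤ R → u i t ∈ Q)
    (hV : ∀ i, Monotone (V i)) (hVC : ∀ i, V i T - V i 0 ≤ C)
    (huV : ∀ ε > 0, ∃ D : ℝ, 0 ≤ D ∧ ∀ i s t, 0 < s → s ≤ t → t ≤ T →
      ‖u i t - u i s‖ ≤ ε * (h i t + h i s) + D * (V i t - V i s)) :
    TotallyBounded (range fun i => (hu i).toLp (u i)) := by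
  have hp : 1 ≤ p := Fact.out
  have hpr : 0 < p.toReal := ENNReal.toReal_pos (zero_lt_one.trans_le hp).ne' hp'
  refine totallyBounded_of_forall_exists_approx fun ε hε => ?_
  obtain ⟨D, hD, hDu⟩ := huV (ε / (4 * (K + 1))) (by positivity)
  have hlim : Tendsto (fun m : ℕ => D * (C * (T / ((m : ℝ) + 1)) ^ (1 / p.toReal))) atTop
      (𝓝 (D * (C * 0 ^ (1 / p.toReal)))) := by
    refine ((Tendsto.rpow_const ?_ (Or.inr (by positivity))).const_mul C).const_mul D
    simpa [div_eq_mul_inv] using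
      (tendsto_one_div_add_atTop_nhds_zero_nat (𝕜 := ℝ)).const_mul T
  rw [Real.zero_rpow (by positivity), mul_zero, mul_zero] at hlim
  obtain ⟨m, hmlt⟩ := (hlim.eventually_lt_const (half_pos hε)).exists
  set σ : ℝ := T / ((m : ℝ) + 1) with hσdef
  have hσ : 0 < σ := by positivity
  have hTσ : T = (m + 1 : ℕ) * σ := by rw [hσdef]; push_cast; field_simp
  obtain ⟨Q, hQ, hQu⟩ := hcomp (K / σ ^ (1 / p.toReal))
  refine ⟨_, totallyBounded_stepFunctions (m := m) (τ := σ) hQ p T, ?_⟩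
  rintro _ ⟨i, rfl⟩
  have key := exists_stepFunction_approx (m := m) hσ hp hp' (u := u i) (h := h i) (V := V i)
    (K := K) (C := C) (D := D) (ε := ε / (4 * (K + 1))) hK (by positivity) hD
  rw [← hTσ] at key
  obtain ⟨x, hx, hle⟩ := key (hm i) (hnn i) (hhK i) (hV i) (hVC i) (hDu i)
  refine ⟨_, ⟨fun j => u i (x j), fun j _ => hQu i _ (hx j).1 (hx j).2, rfl⟩, ?_⟩
  rw [dist_edist, Lp.edist_toLp_toLp]
  have hlast : 2 * (ε / (4 * (K + 1))) * K + D * (C * σ ^ (1 / p.toReal)) ≤ ε := by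
    have h1 : 2 * (ε / (4 * (K + 1))) * K ≤ ε / 2 := by
      rw [show 2 * (ε / (4 * (K + 1))) * K = ε / 2 * (K / (K + 1)) by field_simp; norm_num]
      refine mul_le_of_le_one_right (by positivity) ((div_le_one (by positivity)).2 (by linarith))
    linarith
  exact ENNReal.toReal_le_of_le_ofReal hε.le (hle.trans (ENNReal.ofReal_le_ofReal hlast))

/-! ### Bounded sequences -/

theorem convergesInLq_of_bounded {E : Type*} [NormedAddCommGroup E] {T R : ℝ} {u : ℕ → ℝ → E}
    {f : ℝ → E} (hum : ∀ n, AEStronglyMeasurable (u n) (timeMeasure T))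
    (hR : ∀ n, ∀ t ∈ Ioc 0 T, ‖u n t‖ ≤ R)
    (hlim : ∀ t ∈ Ioc 0 T, Tendsto (fun n => u n t) atTop (𝓝 (f t))) {q : ℝ≥0∞} (hq : 1 ≤ q)
    (hq' : q ≠ ∞) : ConvergesInLq q T u f := by
  have hq0 : q ≠ 0 := (zero_lt_one.trans_le hq).ne'
  have hqr : 0 < q.toReal := ENNReal.toReal_pos hq0 hq'
  have hfm : AEStronglyMeasurable f (timeMeasure T) :=
    aestronglyMeasurable_of_tendsto_ae atTop hum ((ae_timeMeasure_mem T).mono hlim)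
  have hfR : ∀ t ∈ Ioc 0 T, ‖f t‖ ≤ R := fun t ht =>
    le_of_tendsto (hlim t ht).norm (Eventually.of_forall fun n => hR n t ht)
  refine ⟨fun n => MemLp.of_bound (hum n) R ((ae_timeMeasure_mem T).mono (hR n)),
    MemLp.of_bound hfm R ((ae_timeMeasure_mem T).mono hfR), ?_⟩
  have key : Tendsto (fun n => ∫⁻ t, ‖u n t - f t‖ₑ ^ q.toReal ∂timeMeasure T) atTop
      (𝓝 (∫⁻ _, 0 ∂timeMeasure T)) := by
    refine tendsto_lintegral_of_dominated_convergence'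
      (fun _ => ENNReal.ofReal (R + R) ^ q.toReal)
      (fun n => ((hum n).sub hfm).enorm.pow_const _) (fun n => ?_) ?_ ?_
    · filter_upwards [ae_timeMeasure_mem T] with t ht
      refine ENNReal.rpow_le_rpow ?_ hqr.le
      rw [← ofReal_norm]
      exact ENNReal.ofReal_le_ofReal
        ((norm_sub_le _ _).trans (add_le_add (hR n t ht) (hfR t ht)))
    · rw [lintegral_const]
      exact ENNReal.mul_ne_top (ENNReal.rpow_ne_top_of_nonneg hqr.le ENNReal.ofReal_ne_top)
        (measure_ne_top _ _)
    · filter_upwards [ae_timeMeasure_mem T] with t ht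
      have h1 : Tendsto (fun n => ‖u n t - f t‖ₑ) atTop (𝓝 ‖f t - f t‖ₑ) :=
        ((hlim t ht).sub_const _).enorm
      rw [sub_self, enorm_zero] at h1
      simpa [ENNReal.zero_rpow_of_pos hqr] using h1.ennrpow_const q.toReal
  rw [lintegral_zero] at key
  simp only [eLpNorm_eq_lintegral_rpow_enorm_toReal hq0 hq']
  simpa [hqr] using key.ennrpow_const (1 / q.toReal)

/-- An essential bound on a functional of a piecewise constant function holds at every point, since
each cell has positive measure. -/
theorem IsPiecewiseConstant.le_of_eLpNorm_top_le {E : Type*} {τ : ℝ} {N : ℕ} {u : ℝ → E}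
    (hu : IsPiecewiseConstant τ N u) (hτ : 0 < τ) (hN : 0 < N) {h : E → ℝ} {K : ℝ} (hK : 0 ≤ K)
    (hle : eLpNorm (fun t => h (u t)) ∞ (timeMeasure (N * τ)) ≤ ENNReal.ofReal K) {t : ℝ}
    (ht : t ∈ Ioc 0 (N * τ)) : h (u t) ≤ K := by
  have hk := cellIndex_lt hτ hN ht.2
  have hsub := gridCell_subset_Ioc hτ hk
  set μ := volume.restrict (gridCell τ (cellIndex τ t)) with hμ
  have hne : (ae μ).NeBot := by
    rw [ae_neBot, hμ, Ne, Measure.restrict_eq_zero, volume_gridCell]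
    exact (ENNReal.ofReal_pos.2 hτ).ne'
  have hμle : μ ≤ timeMeasure (N * τ) := by
    rw [timeMeasure_eq_restrict_Ioc]
    exact Measure.restrict_mono hsub le_rfl
  rw [eLpNorm_exponent_top] at hle
  have h1 : ∀ᵐ s ∂μ, ‖h (u s)‖ₑ ≤ eLpNormEssSup (fun t => h (u t)) (timeMeasure (N * τ)) :=
    ae_mono hμle (ae_le_eLpNormEssSup (f := fun t => h (u t)))
  obtain ⟨s, hs, hsmem⟩ := (h1.and (ae_restrict_mem measurableSet_gridCell)).exists
  have h2 := hs.trans hle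
  rw [← ofReal_norm, ENNReal.ofReal_le_ofReal_iff hK] at h2
  rw [hu.eq_comp_cellIndex hτ hN ht, ← cellIndex_eq_of_mem hτ hsmem,
    ← hu.eq_comp_cellIndex hτ hN (hsub hsmem)]
  exact (Real.le_norm_self _).trans h2

/-! ### The compactness theorem -/

/-- `B` and `Y` are Banach spaces realised as linear subspaces (through injective linear maps
`iB`, `iY`) of a common real vector space `V` without topology, so that `B ∩ Y` and the vector
operations on it make sense; no continuous embedding is assumed.  `v n` is `u n` seen as
a `Y`-valued function. -/
theorem theorem2
    {B Y V : Type*} [NormedAddCommGroup B] [NormedSpace ℝ B] [CompleteSpace B]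
    [NormedAddCommGroup Y] [NormedSpace ℝ Y] [CompleteSpace Y]
    [AddCommGroup V] [Module ℝ V]
    (iB : B →ₗ[ℝ] V) (hiB : Function.Injective iB)
    (iY : Y →ₗ[ℝ] V) (hiY : Function.Injective iY)
    (M : SeminormedCone B)
    (p r : ℝ≥0∞) [Fact (1 ≤ p)]
    (hpr : (p < ∞ ∧ r = 1) ∨ (p = ∞ ∧ 1 < r))
    (T : ℝ) (hT : 0 < T)
    -- the time grids
    (τ : ℕ → ℝ) (hτ : ∀ n, 0 < τ n) (N : ℕ → ℕ) (hN : ∀ n, T = N n * τ n)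
    -- the piecewise constant functions, with values in `M₊ ∩ Y`
    (u : ℕ → ℝ → B) (hu : ∀ n, MemLp (u n) p (timeMeasure T))
    (hconst : ∀ n, IsPiecewiseConstant (τ n) (N n) (u n))
    (hM : ∀ n, ∀ t ∈ Ioc 0 T, u n t ∈ M.carrier)
    (v : ℕ → ℝ → Y) (hv : ∀ n, ∀ t ∈ Ioc 0 T, iY (v n t) = iB (u n t))
    -- `M₊ ↪ B` compactly
    (hcompact : M.CompactlyEmbedded)
    -- `w n → w₀` in `B` and `w n → 0` in `Y` imply `w₀ = 0`
    (hclosed : ∀ (w : ℕ → B) (y : ℕ → Y) (w₀ : B), (∀ n, iB (w n) = iY (y n)) →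
      Tendsto w atTop (𝓝 w₀) → Tendsto y atTop (𝓝 0) → w₀ = 0)
    -- boundedness in `L^p(0, T; M₊)`
    (hbdd : ∃ K : ℝ, ∀ n,
      eLpNorm (fun t => M.seminorm (u n t)) p (timeMeasure T) ≤ ENNReal.ofReal K)
    -- the estimate of the time shift in `L^r(0, T - τ; Y)`
    (hshift : ∃ C : ℝ, 0 < C ∧ ∀ n,
      eLpNorm (fun t => v n (t + τ n) - v n t) r (timeMeasure (T - τ n))
        ≤ ENNReal.ofReal (C * τ n)) :
    (p < ∞ →
      IsCompact (closure (Set.range fun n => (hu n).toLp (u n)) :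
        Set (Lp B p (timeMeasure T)))) ∧
    (p = ∞ → Tendsto τ atTop (𝓝 0) →
      ∃ φ : ℕ → ℕ, StrictMono φ ∧ ∃ f : ℝ → B, ContinuousOn f (Icc 0 T) ∧
        ∀ q : ℝ≥0∞, 1 ≤ q → q < ∞ → ConvergesInLq q T (fun n => u (φ n)) f) := by
  have hN0 : ∀ n, 0 < N n := fun n => by
    rcases Nat.eq_zero_or_pos (N n) with h | h
    · have := hN n
      rw [h, Nat.cast_zero, zero_mul] at this
      exact absurd this hT.ne'
    · exact h
  have hr : 1 ≤ r := by
    rcases hpr with ⟨-, rfl⟩ | ⟨-, h⟩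
    · exact le_rfl
    · exact h.le
  have hvconst : ∀ n, IsPiecewiseConstant (τ n) (N n) (v n) := fun n k hk hkN s hs t ht => by
    have hsub : Ioc (((k : ℝ) - 1) * τ n) (k * τ n) ⊆ Ioc 0 T := by
      have h1 : (1 : ℝ) ≤ k := by exact_mod_cast hk
      have h2 : (k : ℝ) ≤ N n := by exact_mod_cast hkN
      rw [hN n]
      exact Ioc_subset_Ioc (mul_nonneg (by linarith) (hτ n).le)
        (mul_le_mul_of_nonneg_right h2 (hτ n).le)
    apply hiY
    rw [hv n s (hsub hs), hv n t (hsub ht), hconst n k hk hkN s hs t ht]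
  obtain ⟨C, hC, hshift⟩ := hshift
  have hVex : ∀ n, ∃ V : ℝ → ℝ, Monotone V ∧
      (∀ s t, 0 < s → s ≤ t → t ≤ T → ‖v n t - v n s‖ ≤ V t - V s) ∧
      ∀ s t, 0 ≤ s → s ≤ t → t ≤ T →
        V t - V s ≤ C * (t - s + τ n) ^ (1 - 1 / r.toReal) := fun n => by
    have h := hshift n
    rw [hN n] at h ⊢
    exact exists_monotone_variation (hτ n) (hN0 n) (hvconst n) hr hC h
  choose V hVm hVv hVr using hVex
  obtain ⟨K', hK'⟩ := hbdd
  obtain ⟨K, hK, hKb⟩ : ∃ K : ℝ, 0 ≤ K ∧ ∀ n,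
      eLpNorm (fun t => M.seminorm (u n t)) p (timeMeasure T) ≤ ENNReal.ofReal K :=
    ⟨max K' 0, le_max_right _ _, fun n =>
      (hK' n).trans (ENNReal.ofReal_le_ofReal (le_max_left _ _))⟩
  have hEhr : ∀ ε > 0, ∃ D : ℝ, 0 ≤ D ∧ ∀ n s t, 0 < s → s ≤ t → t ≤ T →
      ‖u n t - u n s‖ ≤
        ε * (M.seminorm (u n t) + M.seminorm (u n s)) + D * (V n t - V n s) := fun ε hε => by
    obtain ⟨D, hD, h⟩ := hcompact.exists_norm_sub_le iB iY hclosed hε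
    refine ⟨D, hD, fun n s t hs hst ht => ?_⟩
    have hsI : s ∈ Ioc 0 T := ⟨hs, hst.trans ht⟩
    have htI : t ∈ Ioc 0 T := ⟨hs.trans_le hst, ht⟩
    refine (h _ (hM n t htI) _ (hM n s hsI) (v n t - v n s) ?_).trans
      (add_le_add_right (mul_le_mul_of_nonneg_left (hVv n s t hs hst ht) hD) _)
    rw [map_sub, map_sub, hv n t htI, hv n s hsI]
  constructor
  · intro hp
    obtain rfl : r = 1 := by
      rcases hpr with ⟨-, h⟩ | ⟨h, -⟩
      · exact h
      · exact absurd h hp.ne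
    refine isCompact_iff_totallyBounded_isComplete.2
      ⟨TotallyBounded.closure ?_, isClosed_closure.isComplete⟩
    refine totallyBounded_range_toLp (C := C) (h := fun n t => M.seminorm (u n t)) (V := V)
      hp.ne hT hu hK (fun n => ?_) (fun n t ht => M.seminorm_nonneg _ (hM n t ht)) hKb
      (fun R => ⟨_, hcompact.isCompact_closure_sublevel R, fun n t ht hR =>
        subset_closure ⟨hM n t ht, hR⟩⟩) hVm (fun n => ?_) hEhr
    · refine AEStronglyMeasurable.congr (stronglyMeasurable_comp_cellIndex (τ := τ n)
        fun k : ℕ => M.seminorm (u n ((k + 1) * τ n))).aestronglyMeasurable ?_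
      filter_upwards [ae_timeMeasure_mem T] with t ht
      rw [hN n] at ht
      rw [(hconst n).eq_comp_cellIndex (hτ n) (hN0 n) ht]
    · simpa using hVr n 0 T le_rfl hT.le le_rfl
  · rintro rfl hτ0
    have hr1 : 1 < r := by
      rcases hpr with ⟨h, -⟩ | ⟨-, h⟩
      · exact absurd h (lt_irrefl _)
      · exact h
    have hα : 0 < 1 - 1 / r.toReal := by
      rcases eq_or_ne r ∞ with rfl | hr'
      · simp
      · have h1 : 1 < r.toReal := by
          simpa using (ENNReal.toReal_lt_toReal ENNReal.one_ne_top hr').2 hr1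
        exact sub_pos.2 ((div_lt_one (by linarith)).2 h1)
    have hsem : ∀ n, ∀ t ∈ Ioc 0 T, M.seminorm (u n t) ≤ K := fun n t ht => by
      have h := hKb n
      rw [hN n] at h ht
      exact (hconst n).le_of_eLpNorm_top_le (hτ n) (hN0 n) hK h ht
    have hQ := hcompact.isCompact_closure_sublevel K
    have huQ : ∀ n, ∀ t ∈ Ioc 0 T, u n t ∈ closure {w | w ∈ M.carrier ∧ M.seminorm w ≤ K} :=
      fun n t ht => subset_closure ⟨hM n t ht, hsem n t ht⟩
    have hτT : ∀ n, τ n ≤ T := fun n => by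
      have h1 : (1 : ℝ) ≤ N n := by exact_mod_cast hN0 n
      rw [hN n]
      exact le_mul_of_one_le_left (hτ n).le h1
    have hmax : ∀ n, ∀ t ∈ Icc 0 T, max t (τ n) ∈ Ioc 0 T := fun n t ht =>
      ⟨lt_max_of_lt_right (hτ n), max_le ht.2 (hτT n)⟩
    -- The value at time `0` is not constrained by the hypotheses; it is replaced by the value on
    -- the first cell.
    have humax : ∀ n, ∀ t ∈ Ioc 0 T, u n (max t (τ n)) = u n t := fun n t ht => by
      rcases le_total (τ n) t with h | h
      · rw [max_eq_left h]
      · rw [max_eq_right h]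
        exact hconst n 1 le_rfl (hN0 n) _ (by simpa using hτ n) _ (by simpa using ⟨ht.1, h⟩)
    obtain ⟨φ, hφ, f, hf, hlim⟩ := exists_subseq_tendsto_of_asymptotically_equicontinuous hQ
      (g := fun n (t : Icc 0 T) => u n (max t (τ n))) (fun n t => huQ n _ (hmax n t t.2)) <| by
        intro ε hε
        obtain ⟨D, hD, hDu⟩ := hEhr (ε / (4 * (K + 1))) (by positivity)
        have hcont : Tendsto (fun x : ℝ => D * (C * x ^ (1 - 1 / r.toReal))) (𝓝 0)
            (𝓝 (D * (C * 0 ^ (1 - 1 / r.toReal)))) :=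
          ((tendsto_id.rpow_const (Or.inr hα.le)).const_mul C).const_mul D
        rw [Real.zero_rpow hα.ne', mul_zero, mul_zero] at hcont
        obtain ⟨η, hη, hηlt⟩ :=
          Metric.eventually_nhds_iff.1 (hcont.eventually_lt_const (half_pos hε))
        refine ⟨η / 2, half_pos hη, ?_⟩
        filter_upwards [hτ0.eventually_lt_const (half_pos hη)] with n hn x y hxy
        have main : ∀ s ∈ Icc 0 T, ∀ t ∈ Icc 0 T, s ≤ t → t - s < η / 2 →
            ‖u n (max t (τ n)) - u n (max s (τ n))‖ ≤ ε := fun s hs t ht hst hlt => by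
          have hs' := hmax n s hs
          have ht' := hmax n t ht
          have hst' : max s (τ n) ≤ max t (τ n) := max_le_max_right _ hst
          have hdiff : max t (τ n) - max s (τ n) ≤ t - s := by
            rcases max_cases t (τ n) with ⟨h1, h2⟩ | ⟨h1, h2⟩ <;>
              rcases max_cases s (τ n) with ⟨h3, h4⟩ | ⟨h3, h4⟩ <;> rw [h1, h3] <;> linarith
          have h1 := hDu n _ _ hs'.1 hst' ht'.2
          have h2 := mul_le_mul_of_nonneg_left (hVr n _ _ hs'.1.le hst' ht'.2) hD
          have h3 : D * (C * (max t (τ n) - max s (τ n) + τ n) ^ (1 - 1 / r.toReal)) < ε / 2 := by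
            refine hηlt ?_
            rw [Real.dist_eq, sub_zero, abs_of_nonneg
              (add_nonneg (sub_nonneg.2 hst') (hτ n).le)]
            linarith
          have h4 : ε / (4 * (K + 1)) * (M.seminorm (u n (max t (τ n))) +
              M.seminorm (u n (max s (τ n)))) ≤ ε / 2 := by
            have h5 : M.seminorm (u n (max t (τ n))) + M.seminorm (u n (max s (τ n))) ≤
                2 * (K + 1) := by linarith [hsem n _ hs', hsem n _ ht']
            refine (mul_le_mul_of_nonneg_left h5 (by positivity)).trans_eq ?_
            field_simp
            norm_num
          linarith
        rw [Subtype.dist_eq, Real.dist_eq] at hxy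
        rcases le_total (x : ℝ) y with h | h
        · rw [dist_comm, dist_eq_norm]
          refine main x x.2 y y.2 h (lt_of_le_of_lt ?_ hxy)
          rw [abs_sub_comm]
          exact le_abs_self _
        · rw [dist_eq_norm]
          exact main y y.2 x x.2 h (lt_of_le_of_lt (le_abs_self _) hxy)
    refine ⟨φ, hφ, IccExtend hT.le f, hf.Icc_extend'.continuousOn, fun q hq hq' => ?_⟩
    obtain ⟨R, hR⟩ := hQ.isBounded.exists_norm_le
    refine convergesInLq_of_bounded (fun n => (hu (φ n)).1)
      (fun n t ht => hR _ (huQ (φ n) t ht)) (fun t ht => ?_) hq hq'.ne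
    have htI : t ∈ Icc 0 T := Ioc_subset_Icc_self ht
    rw [IccExtend_of_mem hT.le f htI]
    exact (hlim ⟨t, htI⟩).congr fun n => humax (φ n) t ht
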